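/- Let $K$ be an algebraically closed field of characteristic $0$, let $m,k\ge 0$ and $a$ be integers, and let $\pi:\mathbb F_m=\mathbb P(\mathcal O_{\mathbb P^1}\oplus\mathcal O_{\mathbb P^1}(m))\to\mathbb P^1$ be the $m$-th Hirzebruch surface, with $\zeta=c_1(\mathcal O_{\mathbb F_m}(1))$ and $\xi=\pi^*c_1(\mathcal O_{\mathbb P^1}(1))$; write $\mathcal O_{\mathbb F_m}(k,a)$ for the line bundle of class $k\zeta+a\xi$. Its global sections are the polynomials $\sum_{i=0}^k f_i(t_0,t_1)u_0^iu_1^{k-i}$ with $f_i$ a binary form of degree $im+a$ ($f_i=0$ if $im+a<0$), where $t_0,t_1$ are the coordinates on $\mathbb P^1$ and $u_0,u_1$ the relative coordinates. Let $s_1\ge\dots\ge s_u>0$ be integers, let $C_1,\dots,C_u$ be general sections of $\pi$ of class $\zeta$, that is, curves $u_1=h_i(t_0,t_1)u_0$ with $h_i\in H^0(\mathbb P^1,\mathcal O(m))$ general, let $S_i$ be a set of $s_i$ general points of $C_i$, and let $Z=S_1\cup\dots\cup S_u$, with ideal sheaf $\mathcal I_Z$. (General means: for all choices in a nonempty Zariski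 open subset of $H^0(\mathbb P^1,\mathcal O(m))^u\times\prod_{i}(\mathbb P^1)^{s_i}$, where a point of $C_i$ is given by its image in $\mathbb P^1$.) For $t\ge1$ put $d_t=\max\{(k-t+1)m+a+1,\,0\}$ if $t\le k+1$ and $d_t=0$ if $t>k+1$, and for $0\le i\le j\le u$ put $$\sigma(i,j)=\sum_{i<t\le j}(d_t-s_t).$$ Let $i_0=0$ and, inductively, $i_t=\min\{j\mid i_{t-1}<j\le u,\ \sigma(i_{t-1},j)<0\}$, as long as such a $j$ exists. Then the $\sum_i s_i$ points of the sets $S_i$ are pairwise distinct, and: i) if $i_t>k+1$ for some $t$, then $h^0(\mathbb F_m,\mathcal I_Z(k,a))=0$; ii) otherwise $$h^0(\mathbb F_m,\mathcal I_Z(k,a))=h^0(\mathbb F_m,\mathcal O_{\mathbb F_m}(k,a))-\sum_{i\le u}s_i-\sum_{t}\sigma(i_{t-1},i_t),$$ the last sum being over the $t\ge1$ for which $i_t$ is defined. -/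

import Mathlib

namespace Hirzebruch

open MvPolynomial

/-! ### The Hirzebruch surface and its homogeneous coordinates

The `m`-th Hirzebruch surface is written as the quotient of
`(K² ∖ 0) × (K² ∖ 0)`, with coordinates `t₀, t₁` (on the base `ℙ¹`) and
`u₀, u₁` (on the fibre), by the action
`(lam, mu) • (t, u₀, u₁) = (lam t, mu lam⁻ᵐ u₀, mu u₁)` of `Kˣ × Kˣ`. -/

/-- The names of the homogeneous coordinates: `inl 0, inl 1` are `t₀, t₁` and
`inr 0, inr 1` are `u₀, u₁`. -/
abbrev Var : Type := Fin 2 ⊕ Fin 2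

/-- Homogeneous coordinates of a point. -/
structure Coords (K : Type*) [Field K] where
  t : Fin 2 → K
  u : Fin 2 → K
  t_ne : t ≠ 0
  u_ne : u ≠ 0

/-- The four coordinates as a valuation of the variables. -/
def Coords.val {K : Type*} [Field K] (x : Coords K) : Var → K := Sum.elim x.t x.u

/-- Two coordinate vectors describe the same point when they lie in one orbit of the torus. -/
def setoid (K : Type*) [Field K] (m : ℕ) : Setoid (Coords K) where
  r x y := ∃ lam mu : Kˣ, y.t = (lam : K) • x.t ∧
    y.u 0 = (mu : K) * ((lam⁻¹ : Kˣ) : K) ^ m * x.u 0 ∧ y.u 1 = (mu : K) * x.u 1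
  iseqv := by
    refine ⟨fun x => ⟨1, 1, by simp⟩, ?_, ?_⟩
    · rintro x y ⟨l, n, h1, h2, h3⟩
      refine ⟨l⁻¹, n⁻¹, ?_, ?_, ?_⟩
      · rw [h1, smul_smul]; simp
      · rw [h2]; simp; field_simp
      · rw [h3]; simp
    · rintro x y z ⟨l, n, h1, h2, h3⟩ ⟨l', n', h1', h2', h3'⟩
      refine ⟨l' * l, n' * n, ?_, ?_, ?_⟩
      · rw [h1', h1, smul_smul]; simp
      · rw [h2', h2]; simp; ring
      · rw [h3', h3]; simp; ring

/-- The (closed) points of the `m`-th Hirzebruch surface over the algebraically closed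
field `K`. -/
def Surface (K : Type*) [Field K] (m : ℕ) : Type _ := Quotient (setoid K m)

/-- The projection of the Hirzebruch surface to the projective line. -/
def proj {K : Type*} [Field K] {m : ℕ} : Surface K m → Projectivization K (Fin 2 → K) :=
  Quotient.lift (fun x : Coords K => Projectivization.mk K x.t x.t_ne) (by
    rintro x y ⟨l, n, h1, -, -⟩
    refine ((Projectivization.mk_eq_mk_iff K _ _ _ _).2 ⟨l⁻¹, ?_⟩)
    show l⁻¹ • y.t = x.t
    rw [h1, Units.smul_def, smul_smul]; simp)

/-- The degrees of the coordinates in `Pic = ℤζ ⊕ ℤξ`: `t₀, t₁` have class `ξ`, `u₀` has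
class `ζ - mξ` (it cuts out the directrix) and `u₁` has class `ζ`. -/
def weight (m : ℕ) : Var → ℤ × ℤ :=
  Sum.elim (fun _ => (0, 1)) ![(1, -(m : ℤ)), (1, 0)]

/-- Global sections of `O(k, a)`: bihomogeneous polynomials of class `(k, a)`, that is,
polynomials `∑ fᵢ(t₀, t₁) u₀ⁱ u₁ᵏ⁻ⁱ` with `fᵢ` homogeneous of degree `i m + a`. -/
noncomputable abbrev forms (K : Type*) [Field K] (m : ℕ) (k a : ℤ) :
    Submodule K (MvPolynomial Var K) :=
  weightedHomogeneousSubmodule K (weight m) (k, a)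

/-- A form vanishes at a point. -/
def VanishesAt {K : Type*} [Field K] {m : ℕ} (F : MvPolynomial Var K) (p : Surface K m) : Prop :=
  ∀ x : Coords K, (Quotient.mk (setoid K m) x : Surface K m) = p → eval x.val F = 0

/-- For a bihomogeneous form the value is rescaled by a unit when the coordinates of the point
are changed. -/
theorem eval_of_rel {K : Type*} [Field K] {m : ℕ} {k a : ℤ} {F : MvPolynomial Var K}
    (hF : F ∈ forms K m k a) {x y : Coords K} {l n : Kˣ} (h1 : y.t = (l : K) • x.t)
    (h2 : y.u 0 = (n : K) * ((l⁻¹ : Kˣ) : K) ^ m * x.u 0) (h3 : y.u 1 = (n : K) * x.u 1) :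
    eval y.val F = (n : K) ^ k * (l : K) ^ a * eval x.val F := by
  have hl : (l : K) ≠ 0 := l.ne_zero
  have hn : (n : K) ≠ 0 := n.ne_zero
  rw [eval_eq', eval_eq', Finset.mul_sum]
  refine Finset.sum_congr rfl fun d hd => ?_
  have hw := hF (mem_support_iff.1 hd)
  rw [Finsupp.weight_apply, Finsupp.sum_fintype _ _ (by simp)] at hw
  simp only [Fintype.sum_sum_type, Fin.sum_univ_two, weight, Sum.elim_inl, Sum.elim_inr,
    Matrix.cons_val_zero, Matrix.cons_val_one, Prod.ext_iff, Prod.fst_add, Prod.snd_add,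
    Prod.smul_fst, Prod.smul_snd] at hw
  obtain ⟨hk, ha⟩ := hw
  simp only [nsmul_eq_mul, mul_zero, mul_one, zero_add, add_zero] at hk ha
  simp only [Fintype.prod_sum_type, Fin.prod_univ_two, Coords.val, Sum.elim_inl, Sum.elim_inr,
    h1, h2, h3, Pi.smul_apply, smul_eq_mul, mul_pow]
  rw [← hk, ← ha]
  have e1 : (l : K) ^ ((d (Sum.inl 0) : ℤ) + d (Sum.inl 1) + d (Sum.inr 0) * -(m : ℤ)) =
      (l : K) ^ d (Sum.inl 0) * (l : K) ^ d (Sum.inl 1) *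
        (((l⁻¹ : Kˣ) : K) ^ m) ^ d (Sum.inr 0) := by
    rw [zpow_add₀ hl, zpow_add₀ hl, zpow_natCast, zpow_natCast, mul_neg, zpow_neg,
      mul_comm ((d (Sum.inr 0) : ℤ)), ← Nat.cast_mul, zpow_natCast, pow_mul]
    simp
  rw [e1, zpow_add₀ hn, zpow_natCast, zpow_natCast]
  ring

/-- Vanishing of a form at a point can be tested on any coordinates of the point. -/
theorem vanishesAt_mk {K : Type*} [Field K] {m : ℕ} {k a : ℤ} {F : MvPolynomial Var K}
    (hF : F ∈ forms K m k a) (x : Coords K) :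
    VanishesAt F (Quotient.mk (setoid K m) x : Surface K m) ↔ eval x.val F = 0 := by
  refine ⟨fun h => h x rfl, fun h y hy => ?_⟩
  obtain ⟨l, n, h1, h2, h3⟩ := Quotient.exact hy.symm
  rw [eval_of_rel hF h1 h2 h3, h, mul_zero]

/-- `H⁰(I_Z(k, a))` for a reduced subscheme `Z`: the forms of class `(k, a)` vanishing at the
points of `Z`. -/
noncomputable def formsThrough (K : Type*) [Field K] (m : ℕ) (k a : ℤ) (Z : Set (Surface K m)) :
    Submodule K (MvPolynomial Var K) where
  carrier := {F | F ∈ forms K m k a ∧ ∀ p ∈ Z, VanishesAt F p}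
  add_mem' := by
    rintro F G ⟨hF, hF'⟩ ⟨hG, hG'⟩
    refine ⟨add_mem hF hG, fun p hp x hx => ?_⟩
    rw [map_add, hF' p hp x hx, hG' p hp x hx, add_zero]
  zero_mem' := ⟨zero_mem _, fun p hp x hx => map_zero _⟩
  smul_mem' := by
    rintro c F ⟨hF, hF'⟩
    refine ⟨Submodule.smul_mem _ c hF, fun p hp x hx => ?_⟩
    rw [smul_eval, hF' p hp x hx, mul_zero]

/-- The space of sections of `O(k, a)` is finite dimensional, so that `finrank` below is its
dimension. -/
instance forms_finite (K : Type*) [Field K] (m : ℕ) (k a : ℤ) :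
    Module.Finite K (forms K m k a) := by
  have hfin : {d : Var →₀ ℕ | Finsupp.weight (weight m) d = (k, a)}.Finite := by
    refine (Set.finite_Iic (Finsupp.equivFunOnFinite.symm
      (fun _ : Var => (k + a + m * k).toNat + k.toNat))).subset ?_
    intro d hw
    rw [Set.mem_ofPred_eq] at hw
    rw [Finsupp.weight_apply, Finsupp.sum_fintype _ _ (by simp)] at hw
    simp only [Fintype.sum_sum_type, Fin.sum_univ_two, weight, Sum.elim_inl, Sum.elim_inr,
      Matrix.cons_val_zero, Matrix.cons_val_one, Prod.ext_iff, Prod.fst_add, Prod.snd_add,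
      Prod.smul_fst, Prod.smul_snd] at hw
    obtain ⟨hk, ha⟩ := hw
    simp only [nsmul_eq_mul, mul_zero, mul_one, zero_add, add_zero] at hk ha
    have h0 : (m : ℤ) * d (Sum.inr 0) ≤ m * k :=
      mul_le_mul_of_nonneg_left (by omega) (by positivity)
    have h1 : (d (Sum.inr 0) : ℤ) * -(m : ℤ) = -((m : ℤ) * d (Sum.inr 0)) := by ring
    rw [h1] at ha
    intro i
    simp only [Finsupp.equivFunOnFinite_symm_apply_apply]
    rcases i with i | i <;> fin_cases i <;> simp <;> omega
  have := hfin.to_subtype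
  let f : forms K m k a →ₗ[K] ({d : Var →₀ ℕ | Finsupp.weight (weight m) d = (k, a)} → K) :=
    LinearMap.pi fun d => (lcoeff K d.1).comp (forms K m k a).subtype
  refine Module.Finite.of_injective f fun F G hFG => Subtype.ext (MvPolynomial.ext _ _ fun d => ?_)
  by_cases hd : Finsupp.weight (weight m) d = (k, a)
  · exact congrFun hFG ⟨d, hd⟩
  · have hF : coeff d F.1 = 0 := by
      by_contra h
      exact hd (F.2 h)
    have hG : coeff d G.1 = 0 := by
      by_contra h
      exact hd (G.2 h)
    rw [hF, hG]

instance formsThrough_finite (K : Type*) [Field K] (m : ℕ) (k a : ℤ) (Z : Set (Surface K m)) :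
    Module.Finite K (formsThrough K m k a Z) :=
  Submodule.finiteDimensional_of_le (S₂ := forms K m k a) fun _ hF => hF.1

/-- `h⁰(O(k, a))`. -/
noncomputable def h0 (K : Type*) [Field K] (m : ℕ) (k a : ℤ) : ℕ :=
  Module.finrank K (forms K m k a)

/-- `h⁰(I_Z(k, a))`. -/
noncomputable def h0Ideal (K : Type*) [Field K] (m : ℕ) (k a : ℤ) (Z : Set (Surface K m)) : ℕ :=
  Module.finrank K (formsThrough K m k a Z)

/-! ### Sections of the projection

The sections of the projection in the class `ζ` are the curves `u₁ = h(t₀, t₁) u₀`,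
with `h` a binary form of degree `m`. -/

/-- The value at `v` of the binary form `h = ∑ cⱼ t₀ʲ t₁ᵐ⁻ʲ`. -/
def binaryForm {K : Type*} [Field K] {m : ℕ} (c : Fin (m + 1) → K) (v : Fin 2 → K) : K :=
  ∑ j : Fin (m + 1), c j * v 0 ^ (j : ℕ) * v 1 ^ (m - (j : ℕ))

theorem binaryForm_smul {K : Type*} [Field K] {m : ℕ} (c : Fin (m + 1) → K) (l : K)
    (v : Fin 2 → K) : binaryForm c (l • v) = l ^ m * binaryForm c v := by
  unfold binaryForm
  rw [Finset.mul_sum]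
  refine Finset.sum_congr rfl fun j _ => ?_
  have : l ^ m = l ^ (j : ℕ) * l ^ (m - (j : ℕ)) := by
    rw [← pow_add]; congr 1; have := j.2; omega
  simp only [Pi.smul_apply, smul_eq_mul, mul_pow, this]
  ring

/-- The section `[t] ↦ [t ; 1 : h(t)]` of the projection, as a map. -/
def sectionPoint {K : Type*} [Field K] {m : ℕ} (c : Fin (m + 1) → K) :
    Projectivization K (Fin 2 → K) → Surface K m :=
  Projectivization.lift
    (fun v : { v : Fin 2 → K // v ≠ 0 } => (Quotient.mk (setoid K m)
      ⟨v.1, ![1, binaryForm c v.1], v.2, fun h => by simpa using congrFun h 0⟩ : Surface K m))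
    (by
      rintro ⟨v, hv⟩ ⟨w, hw⟩ l (rfl : v = l • w)
      have hl : l ≠ 0 := by rintro rfl; simp at hv
      refine Quotient.sound ⟨(Units.mk0 l hl)⁻¹, (Units.mk0 l hl)⁻¹ ^ m, ?_, ?_, ?_⟩
      · simp [smul_smul, hl]
      · simp [hl]
      · simp [binaryForm_smul, hl])

/-- The polynomial `u₁ - h(t₀, t₁) u₀`. -/
noncomputable def sectionForm {K : Type*} [Field K] {m : ℕ} (c : Fin (m + 1) → K) :
    MvPolynomial Var K :=
  X (Sum.inr 1) -
    (∑ j : Fin (m + 1), C (c j) * X (Sum.inl 0) ^ (j : ℕ) * X (Sum.inl 1) ^ (m - (j : ℕ))) *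
      X (Sum.inr 0)

/-- It is a section: composing it with the projection gives the identity of `ℙ¹`. -/
theorem proj_sectionPoint {K : Type*} [Field K] {m : ℕ} (c : Fin (m + 1) → K)
    (q : Projectivization K (Fin 2 → K)) : proj (sectionPoint c q) = q := by
  induction q using Projectivization.ind with
  | h v hv => rfl

/-- Its image is the curve `u₁ - h u₀ = 0`. -/
theorem range_sectionPoint {K : Type*} [Field K] {m : ℕ} (c : Fin (m + 1) → K) :
    Set.range (sectionPoint c) = {p : Surface K m | VanishesAt (sectionForm c) p} := by
  have hev : ∀ x : Coords K, eval x.val (sectionForm c) = x.u 1 - binaryForm c x.t * x.u 0 := by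
    intro x
    simp [sectionForm, binaryForm, Coords.val]
  ext p
  constructor
  · rintro ⟨q, rfl⟩
    induction q using Projectivization.ind with
    | h v hv =>
      intro x hx
      obtain ⟨l, n, h1, h2, h3⟩ := Quotient.exact hx.symm
      rw [hev, h1, h2, h3, binaryForm_smul]
      simp
      field_simp
      simp
  · intro hp
    induction p using Quotient.ind with
    | _ x =>
      have h := hp x rfl
      rw [hev, sub_eq_zero] at h
      have h0 : x.u 0 ≠ 0 := by
        intro h0
        refine x.u_ne (funext fun i => ?_)
        fin_cases i
        · exact h0
        · simp [h, h0]
      refine ⟨Projectivization.mk K x.t x.t_ne, ?_⟩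
      refine Quotient.sound ⟨1, Units.mk0 _ h0, ?_, ?_, ?_⟩
      · simp
      · simp
      · simp [h, mul_comm]

/-! ### General sections and general points on them -/

/-- The parameter space `H⁰(ℙ¹, O(m))ᵘ × ∏ᵢ (ℙ¹)^(sᵢ)` (with `1 ≤ i ≤ u`) of `u` sections
together with `sᵢ` points of `ℙ¹` for the `i`-th of them. It is an irreducible variety. -/
abbrev Params (K : Type*) [Field K] (m u : ℕ) (s : ℕ → ℕ) : Type _ :=
  (Finset.Icc 1 u → Fin (m + 1) → K) ×
    ((Σ i : Finset.Icc 1 u, Fin (s i)) → Projectivization K (Fin 2 → K))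

/-- Zariski open subsets of the parameter space: the preimage in the space with
`K² ∖ 0` in place of each `ℙ¹` is a union of sets given by the non-vanishing of a polynomial
in the coordinates. -/
def IsZariskiOpen {K : Type*} [Field K] {m u : ℕ} {s : ℕ → ℕ} (U : Set (Params K m u s)) : Prop :=
  ∀ (c : Finset.Icc 1 u → Fin (m + 1) → K)
    (v : (Σ i : Finset.Icc 1 u, Fin (s i)) → { v : Fin 2 → K // v ≠ 0 }),
    (c, fun x => Projectivization.mk K (v x).1 (v x).2) ∈ U →
    ∃ G : MvPolynomial
        ((Finset.Icc 1 u × Fin (m + 1)) ⊕ ((Σ i : Finset.Icc 1 u, Fin (s i)) × Fin 2)) K,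
      eval (Sum.elim (fun y => c y.1 y.2) (fun y => (v y.1).1 y.2)) G ≠ 0 ∧
      ∀ (c' : Finset.Icc 1 u → Fin (m + 1) → K)
        (v' : (Σ i : Finset.Icc 1 u, Fin (s i)) → { v : Fin 2 → K // v ≠ 0 }),
        eval (Sum.elim (fun y => c' y.1 y.2) (fun y => (v' y.1).1 y.2)) G ≠ 0 →
        (c', fun x => Projectivization.mk K (v' x).1 (v' x).2) ∈ U

/-- A property holds for general sections and general points on them: it holds on a nonempty
Zariski open subset of the (irreducible) parameter space. -/
def HoldsGenerally {K : Type*} [Field K] {m u : ℕ} {s : ℕ → ℕ}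
    (P : Params K m u s → Prop) : Prop :=
  ∃ U : Set (Params K m u s), IsZariskiOpen U ∧ U.Nonempty ∧ ∀ x ∈ U, P x

/-- The `l`-th point of `Sᵢ`, on the `i`-th section. -/
def point {K : Type*} [Field K] {m u : ℕ} {s : ℕ → ℕ} (x : Params K m u s)
    (y : Σ i : Finset.Icc 1 u, Fin (s i)) : Surface K m :=
  sectionPoint (x.1 y.1) (x.2 y)

/-- The union `Z` of the sets `Sᵢ`. -/
def points {K : Type*} [Field K] {m u : ℕ} {s : ℕ → ℕ} (x : Params K m u s) :
    Set (Surface K m) :=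
  Set.range (point x)

/-! ### The numerical functions -/

/-- The number of conditions that vanishing on the `t`-th section adds, `t ≥ 1`:
`max {(k - t + 1) m + a + 1, 0}` for `t ≤ k + 1`, and none for `t > k + 1`. -/
def blockSize (m k : ℕ) (a : ℤ) (t : ℕ) : ℤ :=
  if t ≤ k + 1 then max (((k : ℤ) - t + 1) * m + a + 1) 0 else 0

/-- `σ(i, j) = ∑_{i < t ≤ j} (d_t - s_t)`, where `d_t` is `blockSize`. -/
def sigma (m k : ℕ) (a : ℤ) (s : ℕ → ℕ) (i j : ℕ) : ℤ :=
  ∑ t ∈ Finset.Ioc i j, (blockSize m k a t - (s t : ℤ))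

/-- The indices `i₀ = 0` and `iₜ = min {j | i_{t-1} < j ≤ u, σ(i_{t-1}, j) < 0}`; when there is
no such `j` the sequence stays constant (the infimum of the empty set of naturals is `0`), so
that the remaining terms contribute `σ(i, i) = 0`. -/
noncomputable def index (m k : ℕ) (a : ℤ) (u : ℕ) (s : ℕ → ℕ) : ℕ → ℕ
  | 0 => 0
  | t + 1 => max (index m k a u s t)
      (sInf {j | index m k a u s t < j ∧ j ≤ u ∧ sigma m k a s (index m k a u s t) j < 0})

end Hirzebruch

/-!
Write `D t` for the number of coefficients of the `t`-th block, so that `h⁰(O(k, a)) = ∑ D t`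
(`h0_eq_sum`). The rank of the evaluation map at `Z` is bounded from above for every choice of the
sections and points, and from below for a general one.

*Upper bound on the rank.* Let `p` be the last of the indices `iₜ`. The forms of class `(k - p, a)`
vanishing at the points of the last `u - p` sections, multiplied by the equations of the first `p`
sections, vanish on all of `Z`; this gives `h0_le_h0Ideal_add`.

*Lower bound on the rank.* That a fixed subset `T` of the points imposes independent conditions is
a Zariski open property, as it is detected by a determinant
(`isZariskiOpen_imposeIndependentConditions`), and the parameter space is irreducible
(`HoldsGenerally.and`). So one choice of the parameters at which a subset `T` of the expected size
is independent suffices. Constant sections `u₁ = i t₁ᵐ u₀` and points of the grid with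
`t₀ / t₁ = b` a natural number do. Suppose that on each fibre `t₀ = b t₁` there are at most as many
points of `T` as there are blocks with `D > b`. Then, for a point of `T` on the fibre `b`, the
product of the earlier fibres, of the sections through the other points of its own fibre and of
powers of `t₁` and `u₀` is a form of class `(k, a)`, and the evaluation matrix of these forms
is triangular with respect to `b` (`exists_imposeIndependentConditions`).

Arranging `r i` points on the `i`-th section, for all `i`, in such a grid is a problem on
0-1-matrices with given row sums and bounded column sums. As in the Gale-Ryser theorem it is
solvable when `r` is nonincreasing and its partial sums are at most those of `D`
(`exists_rows_of_sum_le`). A largest such `r ≤ s` is obtained greedily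
(`truncated`): the room left over after `j` sections obeys `e (j + 1) = max (e j + D j - s j) 0`.
It vanishes at every `iₜ` and equals `σ(iₜ, j)` from there to the next index, which identifies
`∑ r` with the expected rank (`sum_truncated`).
-/

namespace Hirzebruch

open MvPolynomial Finset

/-! ### Zero-one matrices with prescribed row sums -/

/-- The sufficient half of the Gale-Ryser theorem, with weak domination: if `s` is nonincreasing
and its partial sums are at most those of `D`, then there are sets `M i` (the rows of a
0-1-matrix) with `s i` elements whose column sums are at most those of the diagram with rows
`D i`. The rows of the diagram are changed into the wanted ones by moving, one at a time, a unit
from a row which is too long to a later one which is too short. -/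
theorem exists_rows_of_sum_le (D s : ℕ → ℕ) (N : ℕ) (hs : Antitone s)
    (h : ∀ j ≤ N, ∑ i ∈ range j, s i ≤ ∑ i ∈ range j, D i) :
    ∃ M : ℕ → Finset ℕ, (∀ i < N, #(M i) = s i) ∧
      ∀ b, #{i ∈ range N | b ∈ M i} ≤ #{i ∈ range N | b < D i} := by
  -- Induction on the total deficit `∑ (s i - #(M i))` of the rows that are too short.
  suffices H : ∀ n : ℕ, ∀ M : ℕ → Finset ℕ, ∑ i ∈ range N, (s i - #(M i)) = n →
      (∀ j ≤ N, ∑ i ∈ range j, s i ≤ ∑ i ∈ range j, #(M i)) →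
      (∀ b, #{i ∈ range N | b ∈ M i} ≤ #{i ∈ range N | b < D i}) →
      ∃ M : ℕ → Finset ℕ, (∀ i < N, #(M i) = s i) ∧
        ∀ b, #{i ∈ range N | b ∈ M i} ≤ #{i ∈ range N | b < D i} by
    exact H _ (fun i => range (D i)) rfl (by simpa using h) (by simp)
  intro n
  induction n using Nat.strong_induction_on with
  | _ n ih =>
  intro M hn hP hcol
  by_cases hge : ∀ i < N, s i ≤ #(M i)
  · have hsub : ∀ i, ∃ A ⊆ M i, i < N → #A = s i := fun i => by
      by_cases hi : i < N
      · obtain ⟨A, hA, hc⟩ := exists_subset_card_eq (hge i hi)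
        exact ⟨A, hA, fun _ => hc⟩
      · exact ⟨∅, by simp, fun h => absurd h hi⟩
    choose A hA hc using hsub
    refine ⟨A, hc, fun b => (card_le_card fun i => ?_).trans (hcol b)⟩
    simp only [mem_filter]
    exact fun hi => ⟨hi.1, hA i hi.2⟩
  · push Not at hge
    classical
    let q := Nat.find hge
    obtain ⟨hqN, hq⟩ : q < N ∧ #(M q) < s q := Nat.find_spec hge
    have hlt : ∀ i < q, s i ≤ #(M i) := fun i hi => by
      have := Nat.find_min hge hi
      push Not at this
      exact this (hi.trans hqN)
    obtain ⟨i, hiq, hi⟩ : ∃ i < q, s i < #(M i) := by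
      by_contra! hcon
      have h1 := hP (q + 1) hqN
      rw [sum_range_succ, sum_range_succ] at h1
      have h2 : ∑ i ∈ range q, #(M i) ≤ ∑ i ∈ range q, s i :=
        sum_le_sum fun i hi => hcon i (mem_range.1 hi)
      omega
    -- Row `i` is strictly longer than row `q`, so a unit can be moved within a column.
    have hcard : #(M q) < #(M i) := hq.trans_le ((hs hiq.le).trans hi.le)
    obtain ⟨b, hbi, hbq⟩ := exists_mem_notMem_of_card_lt_card hcard
    let M' : ℕ → Finset ℕ :=
      Function.update (Function.update M i ((M i).erase b)) q (insert b (M q))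
    have hMq : M' q = insert b (M q) := by simp [M']
    have hMi : M' i = (M i).erase b := by simp [M', hiq.ne]
    have hMo : ∀ j, j ≠ i → j ≠ q → M' j = M j := fun j h1 h2 => by simp [M', h1, h2]
    have hcq : #(M' q) = #(M q) + 1 := by rw [hMq, card_insert_of_notMem hbq]
    have hci : #(M' i) + 1 = #(M i) := by rw [hMi, card_erase_add_one hbi]
    refine ih _ ?_ M' rfl ?_ ?_
    · rw [← hn]
      refine sum_lt_sum (fun j _ => ?_) ⟨q, mem_range.2 hqN, by omega⟩
      rcases eq_or_ne j i with rfl | h1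
      · omega
      · rcases eq_or_ne j q with rfl | h2
        · omega
        · rw [hMo j h1 h2]
    · intro j hj
      have hsum : ∀ j, (∑ l ∈ range j, #(M' l)) + (if i < j then 1 else 0) =
          (∑ l ∈ range j, #(M l)) + (if q < j then 1 else 0) := by
        intro j
        induction j with
        | zero => simp
        | succ j ihj =>
          rw [sum_range_succ, sum_range_succ]
          rcases eq_or_ne j i with rfl | h1
          · split_ifs at ihj ⊢ <;> omega
          · rcases eq_or_ne j q with rfl | h2
            · split_ifs at ihj ⊢ <;> omega
            · rw [hMo j h1 h2]
              split_ifs at ihj ⊢ <;> omega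
      have h1 := hsum j
      have h2 := hP j hj
      by_cases hij : i < j
      · by_cases hqj : q < j
        · simp only [hij, hqj, if_true] at h1; omega
        · -- Only the partial sums strictly between `i` and `q` drop, and there they had room.
          have : ∑ l ∈ range j, s l < ∑ l ∈ range j, #(M l) :=
            sum_lt_sum (fun l hl => hlt l (by have := mem_range.1 hl; omega))
              ⟨i, mem_range.2 hij, hi⟩
          simp only [hij, hqj, if_true, if_false] at h1; omega
      · have hqj : ¬ q < j := by omega
        simp only [hij, hqj, if_false] at h1; omega
    · intro b'
      refine le_trans ?_ (hcol b')
      rcases eq_or_ne b' b with rfl | hb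
      · have h1 : ({l ∈ range N | b' ∈ M' l} : Finset ℕ) ⊆
            insert q (({l ∈ range N | b' ∈ M l} : Finset ℕ).erase i) := by
          intro l hl
          rw [mem_filter] at hl
          rcases eq_or_ne l q with rfl | h2
          · simp
          · have h1 : l ≠ i := by
              rintro rfl
              rw [hMi] at hl
              simp at hl
            rw [hMo l h1 h2] at hl
            simp only [mem_insert, mem_erase, mem_filter]
            exact Or.inr ⟨h1, hl⟩
        refine (card_le_card h1).trans ((card_insert_le _ _).trans ?_)
        rw [card_erase_add_one]
        simp only [mem_filter, mem_range]
        exact ⟨by omega, hbi⟩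
      · refine card_le_card fun l hl => ?_
        rw [mem_filter] at hl ⊢
        refine ⟨hl.1, ?_⟩
        rcases eq_or_ne l q with rfl | h2
        · simpa [hMq, hb] using hl.2
        · rcases eq_or_ne l i with rfl | h1
          · have := hl.2
            rw [hMi] at this
            exact mem_of_mem_erase this
          · rw [← hMo l h1 h2]; exact hl.2

/-! ### The greedy choice of the number of independent points -/

/-- The number of conditions on the first `j` blocks that remain free after using as many as
possible of the first `j` sets, of sizes `S`. The truncated subtraction is intended: points in
excess of the available room are lost and do not count against later blocks. -/
def slack (D S : ℕ → ℕ) : ℕ → ℕ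
  | 0 => 0
  | j + 1 => slack D S j + D j - S j

/-- The number of points of the `j`-th set that are used in the greedy choice. -/
def truncated (D S : ℕ → ℕ) (j : ℕ) : ℕ := min (S j) (slack D S j + D j)

theorem sum_truncated_add_slack (D S : ℕ → ℕ) (j : ℕ) :
    ∑ i ∈ range j, truncated D S i + slack D S j = ∑ i ∈ range j, D i := by
  induction j with
  | zero => simp [slack]
  | succ j ih =>
    rw [sum_range_succ, sum_range_succ, ← ih, slack, truncated]
    omega

theorem antitone_truncated {D S : ℕ → ℕ} (hD : Antitone D) (hS : Antitone S) :
    Antitone (truncated D S) := by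
  refine antitone_nat_of_succ_le fun j => ?_
  have h1 := hD (Nat.le_add_right j 1)
  have h2 := hS (Nat.le_add_right j 1)
  simp only [truncated, slack]
  omega

theorem sigma_succ (m k : ℕ) (a : ℤ) (s : ℕ → ℕ) {i j : ℕ} (h : i ≤ j) :
    sigma m k a s i (j + 1) = sigma m k a s i j + (blockSize m k a (j + 1) - s (j + 1)) := by
  rw [sigma, sigma, sum_Ioc_succ_top h]

theorem sigma_add (m k : ℕ) (a : ℤ) (s : ℕ → ℕ) {i j l : ℕ} (h : i ≤ j) (h' : j ≤ l) :
    sigma m k a s i j + sigma m k a s j l = sigma m k a s i l :=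
  sum_Ioc_consecutive _ h h'

theorem blockSize_nonneg (m k : ℕ) (a : ℤ) (t : ℕ) : 0 ≤ blockSize m k a t := by
  unfold blockSize; split_ifs <;> simp

theorem blockSize_anti (m k : ℕ) (a : ℤ) : Antitone (blockSize m k a) := by
  refine antitone_nat_of_succ_le fun t => ?_
  unfold blockSize
  split_ifs with h1 h2
  · refine max_le_max ?_ le_rfl
    have : (0 : ℤ) ≤ m := by positivity
    push_cast
    nlinarith
  · omega
  · simp
  · rfl

/-- The block sizes as natural numbers, with indices starting at `0`. -/
def blocks (m k : ℕ) (a : ℤ) (t : ℕ) : ℕ := (blockSize m k a (t + 1)).toNat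

/-- The sizes of the point sets, with indices starting at `0` and extended by `0` beyond `u`. -/
def sizes (u : ℕ) (s : ℕ → ℕ) (t : ℕ) : ℕ := if t < u then s (t + 1) else 0

theorem blocks_cast (m k : ℕ) (a : ℤ) (t : ℕ) : (blocks m k a t : ℤ) = blockSize m k a (t + 1) :=
  Int.toNat_of_nonneg (blockSize_nonneg _ _ _ _)

theorem antitone_blocks (m k : ℕ) (a : ℤ) : Antitone (blocks m k a) := fun _ _ h =>
  Int.toNat_le_toNat (blockSize_anti m k a (Nat.succ_le_succ h))

theorem antitone_sizes {u : ℕ} {s : ℕ → ℕ} (hs : ∀ i j : ℕ, 1 ≤ i → i ≤ j → j ≤ u → s j ≤ s i) :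
    Antitone (sizes u s) := by
  intro i j h
  unfold sizes
  split_ifs with h1 h2
  · exact hs _ _ (by omega) (by omega) (by omega)
  · omega
  · simp
  · rfl

/-! ### The indices and the expected rank -/

section Index

variable (m k : ℕ) (a : ℤ) (u : ℕ) (s : ℕ → ℕ)

/-- Either the sequence of indices has come to an end, and then it stays constant, or the next
index is the first one at which `σ` is negative. -/
theorem index_step (t : ℕ) :
    (index m k a u s (t + 1) = index m k a u s t ∧
      ∀ j, index m k a u s t < j → j ≤ u → 0 ≤ sigma m k a s (index m k a u s t) j) ∨
    (index m k a u s t < index m k a u s (t + 1) ∧ index m k a u s (t + 1) ≤ u ∧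
      sigma m k a s (index m k a u s t) (index m k a u s (t + 1)) < 0 ∧
      ∀ j, index m k a u s t < j → j < index m k a u s (t + 1) →
        0 ≤ sigma m k a s (index m k a u s t) j) := by
  set i := index m k a u s t with hi
  have hnext : index m k a u s (t + 1) =
    max i (sInf {j | i < j ∧ j ≤ u ∧ sigma m k a s i j < 0}) := rfl
  set A := {j | i < j ∧ j ≤ u ∧ sigma m k a s i j < 0} with hA
  rcases A.eq_empty_or_nonempty with h | h
  · left
    refine ⟨by rw [hnext, h]; simp, fun j h1 h2 => ?_⟩
    by_contra h3
    have : j ∈ A := ⟨h1, h2, not_le.1 h3⟩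
    simp [h] at this
  · right
    have hmem := Nat.sInf_mem h
    rw [hnext, max_eq_right hmem.1.le]
    refine ⟨hmem.1, hmem.2.1, hmem.2.2, fun j h1 h2 => ?_⟩
    by_contra h3
    exact Nat.notMem_of_lt_sInf h2 ⟨h1, h2.le.trans hmem.2.1, not_le.1 h3⟩

theorem index_mono : Monotone (index m k a u s) :=
  monotone_nat_of_le_succ fun _ => le_max_left _ _

theorem index_le (t : ℕ) : index m k a u s t ≤ u := by
  induction t with
  | zero => simp [index]
  | succ t ih => rcases index_step m k a u s t with h | h <;> omega

/-- The sequence of indices has come to an end after at most `u` steps, as it grows at each. -/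
theorem sigma_index_nonneg (j : ℕ) (h : index m k a u s u < j) (hj : j ≤ u) :
    0 ≤ sigma m k a s (index m k a u s u) j := by
  -- At each `t`, the sequence has ended or has grown to at least `t`.
  have key : ∀ t, (∀ j, index m k a u s t < j → j ≤ u →
      0 ≤ sigma m k a s (index m k a u s t) j) ∨ t ≤ index m k a u s t := by
    intro t
    induction t with
    | zero => right; simp
    | succ t ih =>
      rcases index_step m k a u s t with h | h
      · left; rw [h.1]; exact h.2
      · rcases ih with h' | h'
        · exact absurd (h' _ h.1 h.2.1) (not_le.2 h.2.2.1)
        · right; omega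
  rcases key u with h' | h'
  · exact h' j h hj
  · omega

theorem index_le_index (t : ℕ) : index m k a u s t ≤ index m k a u s u := by
  rcases le_total t u with h | h
  · exact index_mono m k a u s h
  · refine le_of_eq ?_
    induction t, h using Nat.le_induction with
    | base => rfl
    | succ t _ ih =>
      rcases index_step m k a u s t with h' | h'
      · rw [h'.1, ih]
      · rw [ih] at h'
        exact absurd (sigma_index_nonneg m k a u s _ h'.1 h'.2.1) (not_le.2 h'.2.2.1)

theorem sum_sigma_index (n : ℕ) :
    ∑ t ∈ range n, sigma m k a s (index m k a u s t) (index m k a u s (t + 1)) =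
      sigma m k a s 0 (index m k a u s n) := by
  induction n with
  | zero => simp [index, sigma]
  | succ n ih =>
    rw [sum_range_succ, ih, sigma_add _ _ _ _ (Nat.zero_le _) (index_mono m k a u s n.le_succ)]

/-- After a point at which the slack vanishes, the slack is `σ` as long as `σ` is nonnegative. -/
theorem slack_eq_sigma {i j : ℕ} (h0 : slack (blocks m k a) (sizes u s) i = 0) (hij : i ≤ j)
    (hj : j ≤ u) (h : ∀ l, i < l → l ≤ j → 0 ≤ sigma m k a s i l) :
    (slack (blocks m k a) (sizes u s) j : ℤ) = sigma m k a s i j := by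
  induction j, hij using Nat.le_induction with
  | base => simp [h0, sigma]
  | succ j hij ih =>
    have h1 := ih (by omega) fun l h1 h2 => h l h1 (by omega)
    have h2 := h (j + 1) (by omega) le_rfl
    have h3 := blocks_cast m k a j
    rw [sigma_succ _ _ _ _ hij] at h2 ⊢
    have h4 : sizes u s j = s (j + 1) := if_pos (by omega)
    rw [slack, h4]
    omega

theorem slack_index (t : ℕ) : slack (blocks m k a) (sizes u s) (index m k a u s t) = 0 := by
  induction t with
  | zero => rfl
  | succ t ih =>
    rcases index_step m k a u s t with h | ⟨h1, h2, h3, h4⟩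
    · rw [h.1, ih]
    · obtain ⟨j, hj⟩ : ∃ j, index m k a u s (t + 1) = j + 1 := ⟨_, (Nat.succ_pred (by omega)).symm⟩
      rw [hj] at h1 h2 h3 h4 ⊢
      have h5 := slack_eq_sigma m k a u s ih (Nat.lt_succ_iff.1 h1) (by omega)
        fun l hl hl' => h4 l hl (by omega)
      rw [sigma_succ _ _ _ _ (Nat.lt_succ_iff.1 h1)] at h3
      have h6 := blocks_cast m k a j
      have h7 : sizes u s j = s (j + 1) := if_pos (by omega)
      rw [slack, h7]
      omega

theorem sigma_zero (j : ℕ) : sigma m k a s 0 j =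
    ((∑ i ∈ range j, blocks m k a i : ℕ) : ℤ) - ∑ i ∈ Ioc 0 j, (s i : ℤ) := by
  rw [sigma, sum_sub_distrib]
  congr 1
  rw [Nat.cast_sum, range_eq_Ico, ← Finset.Ico_add_one_add_one_eq_Ioc,
    ← Finset.sum_Ico_add' _ 0 j 1]
  exact sum_congr rfl fun i _ => (blocks_cast m k a i).symm

/-- The total number of points in the greedy choice is the expected rank of the evaluation map. -/
theorem sum_truncated :
    ((∑ i ∈ range u, truncated (blocks m k a) (sizes u s) i : ℕ) : ℤ) =
      sigma m k a s 0 (index m k a u s u) + ∑ i ∈ Icc 1 u, (s i : ℤ) := by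
  have h1 := slack_eq_sigma m k a u s (slack_index m k a u s u) (index_le m k a u s u) le_rfl
    fun l h1 h2 => sigma_index_nonneg m k a u s l h1 h2
  have h2 := sum_truncated_add_slack (blocks m k a) (sizes u s) u
  have h3 := sigma_add m k a s (Nat.zero_le _) (index_le m k a u s u)
  have h4 : sigma m k a s 0 u = ((∑ i ∈ range u, blocks m k a i : ℕ) : ℤ) -
      ∑ i ∈ Icc 1 u, (s i : ℤ) := sigma_zero m k a s u
  omega

end Index

/-! ### Zariski open sets of parameters -/

section Open
variable {K : Type*} [Field K] {m u : ℕ} {s : ℕ → ℕ}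

theorem exists_eval_ne_zero [Infinite K] {σ : Type*} {G : MvPolynomial σ K} (hG : G ≠ 0) :
    ∃ θ : σ → K, eval θ G ≠ 0 := by
  by_contra! h
  exact hG (MvPolynomial.funext fun θ => by simp [h])

/-- The parameter space is irreducible: two nonempty Zariski open sets meet. -/
theorem HoldsGenerally.and [Infinite K] {P Q : Params K m u s → Prop}
    (hP : HoldsGenerally P) (hQ : HoldsGenerally Q) : HoldsGenerally fun x => P x ∧ Q x := by
  obtain ⟨U, hU, ⟨⟨c, q⟩, hx⟩, hUP⟩ := hP
  obtain ⟨V, hV, ⟨⟨c', q'⟩, hx'⟩, hVQ⟩ := hQ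
  refine ⟨U ∩ V, ?_, ?_, fun x hx => ⟨hUP x hx.1, hVQ x hx.2⟩⟩
  · rintro c v ⟨h1, h2⟩
    obtain ⟨G, hG, hG'⟩ := hU c v h1
    obtain ⟨H, hH, hH'⟩ := hV c v h2
    refine ⟨G * H, by simp [hG, hH], fun c' v' h => ?_⟩
    rw [map_mul] at h
    exact ⟨hG' c' v' (left_ne_zero_of_mul h), hH' c' v' (right_ne_zero_of_mul h)⟩
  · have hrep : ∀ q : (Σ i : Finset.Icc 1 u, Fin (s i)) → Projectivization K (Fin 2 → K),
        q = fun y => Projectivization.mk K (q y).rep (q y).rep_nonzero := fun q =>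
      _root_.funext fun y => (q y).mk_rep.symm
    rw [hrep q] at hx
    rw [hrep q'] at hx'
    obtain ⟨G, hG, hG'⟩ := hU c (fun y => ⟨(q y).rep, (q y).rep_nonzero⟩) hx
    obtain ⟨H, hH, hH'⟩ := hV c' (fun y => ⟨(q' y).rep, (q' y).rep_nonzero⟩) hx'
    -- `D ≠ 0` makes the vectors of `K²` nonzero, so that they define points of `ℙ¹`.
    let D : MvPolynomial ((Finset.Icc 1 u × Fin (m + 1)) ⊕
      ((Σ i : Finset.Icc 1 u, Fin (s i)) × Fin 2)) K := ∏ y, X (Sum.inr (y, 0))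
    have hne : G * H * D ≠ 0 := by
      refine mul_ne_zero (mul_ne_zero ?_ ?_) (prod_ne_zero_iff.2 fun y _ => X_ne_zero _)
      · rintro rfl; simp at hG
      · rintro rfl; simp at hH
    obtain ⟨θ, hθ⟩ := exists_eval_ne_zero hne
    rw [map_mul, map_mul] at hθ
    have hD : ∀ y, θ (Sum.inr (y, 0)) ≠ 0 := fun y => by
      have := right_ne_zero_of_mul hθ
      simp only [D, map_prod, eval_X] at this
      exact prod_ne_zero_iff.1 this y (mem_univ y)
    let c₀ : Finset.Icc 1 u → Fin (m + 1) → K := fun i j => θ (Sum.inl (i, j))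
    let v₀ : (Σ i : Finset.Icc 1 u, Fin (s i)) → { v : Fin 2 → K // v ≠ 0 } := fun y =>
      ⟨fun j => θ (Sum.inr (y, j)), fun h => hD y (congrFun h 0)⟩
    have hθ' : θ = Sum.elim (fun y => c₀ y.1 y.2) (fun y => (v₀ y.1).1 y.2) := by
      ext (y | y) <;> rfl
    refine ⟨_, hG' c₀ v₀ ?_, hH' c₀ v₀ ?_⟩
    · rw [← hθ']; exact left_ne_zero_of_mul (left_ne_zero_of_mul hθ)
    · rw [← hθ']; exact right_ne_zero_of_mul (left_ne_zero_of_mul hθ)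

/-- Two points of `ℙ¹` agree when the determinant of their coordinate vectors vanishes. -/
theorem mk_eq_mk_iff_det {v w : Fin 2 → K} (hv : v ≠ 0) (hw : w ≠ 0) :
    Projectivization.mk K v hv = Projectivization.mk K w hw ↔ v 0 * w 1 - v 1 * w 0 = 0 := by
  rw [Projectivization.mk_eq_mk_iff']
  constructor
  · rintro ⟨l, rfl⟩
    simp; ring
  · intro h
    rw [sub_eq_zero] at h
    by_cases h0 : w 0 = 0
    · have h1 : w 1 ≠ 0 := fun h1 => hw (by ext i; fin_cases i <;> simp [h0, h1])
      refine ⟨v 1 / w 1, ?_⟩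
      ext i
      fin_cases i
      · simp only [h0, mul_zero, mul_eq_zero, h1, or_false] at h
        simp [h0, h]
      · simp [h1]
    · refine ⟨v 0 / w 0, ?_⟩
      ext i
      fin_cases i
      · simp [h0]
      · simp only [Fin.mk_one, Pi.smul_apply, smul_eq_mul]
        field_simp
        linear_combination h

theorem point_injective {x : Params K m u s} (h : Function.Injective x.2) :
    Function.Injective (point x) := fun y y' hyy => h (by
  have := congrArg proj hyy
  simpa only [point, proj_sectionPoint] using this)

theorem holdsGenerally_point_injective [Infinite K] :
    HoldsGenerally fun x : Params K m u s => Function.Injective (point x) := by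
  classical
  refine ⟨{x | Function.Injective x.2}, ?_, ?_, fun x hx => point_injective hx⟩
  · intro c v h
    refine ⟨∏ y : (Σ i : Finset.Icc 1 u, Fin (s i)), ∏ y' ∈ univ.erase y,
      (X (Sum.inr (y, 0)) * X (Sum.inr (y', 1)) - X (Sum.inr (y, 1)) * X (Sum.inr (y', 0))),
      ?_, fun c' v' h' => ?_⟩
    · simp only [map_prod, map_sub, map_mul, eval_X, Sum.elim_inr]
      refine prod_ne_zero_iff.2 fun y _ => prod_ne_zero_iff.2 fun y' hy' => ?_
      rw [Ne, ← mk_eq_mk_iff_det (v y).2 (v y').2]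
      exact fun h1 => (mem_erase.1 hy').1 (h h1).symm
    · simp only [map_prod, map_sub, map_mul, eval_X, Sum.elim_inr] at h'
      intro y y' hyy
      by_contra hne
      have h1 := prod_ne_zero_iff.1 (prod_ne_zero_iff.1 h' y (mem_univ y)) y'
        (mem_erase.2 ⟨fun h => hne h.symm, mem_univ _⟩)
      exact h1 ((mk_eq_mk_iff_det _ _).1 hyy)
  · obtain ⟨f⟩ : Nonempty ((Σ i : Finset.Icc 1 u, Fin (s i)) ↪ K) :=
      ⟨((Fintype.equivFin _).toEmbedding.trans Fin.valEmbedding).trans (Infinite.natEmbedding K)⟩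
    refine ⟨(0, fun y => Projectivization.mk K ![f y, 1] fun h => by simpa using congrFun h 1),
      fun y y' h => f.injective ?_⟩
    have := (mk_eq_mk_iff_det _ _).1 h
    simpa [sub_eq_zero] using this

end Open

/-! ### Evaluation of forms at points of a section -/

section Coordinates
variable {K : Type*} [Field K] {m : ℕ}

/-- The homogeneous coordinates `(v; 1, h(v))` of the point over `[v]` of the section `u₁ = h u₀`. -/
def sectionCoords (c : Fin (m + 1) → K) (v : { v : Fin 2 → K // v ≠ 0 }) : Coords K :=
  ⟨v.1, ![1, binaryForm c v.1], v.2, fun h => by simpa using congrFun h 0⟩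

theorem vanishesAt_sectionPoint {k a : ℤ} {F : MvPolynomial Var K} (hF : F ∈ forms K m k a)
    (c : Fin (m + 1) → K) (v : { v : Fin 2 → K // v ≠ 0 }) :
    VanishesAt F (sectionPoint c (Projectivization.mk K v.1 v.2)) ↔
      eval (sectionCoords c v).val F = 0 :=
  vanishesAt_mk hF (sectionCoords c v)

theorem eval_sectionForm (c c' : Fin (m + 1) → K) (v : { v : Fin 2 → K // v ≠ 0 }) :
    eval (sectionCoords c' v).val (sectionForm c) = binaryForm c' v.1 - binaryForm c v.1 := by
  simp [sectionForm, binaryForm, sectionCoords, Coords.val]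

theorem sectionForm_mem (c : Fin (m + 1) → K) : sectionForm c ∈ forms K m 1 0 := by
  have h : ∀ v : Var, IsWeightedHomogeneous (weight m) (X v : MvPolynomial Var K) (weight m v) :=
    fun v => isWeightedHomogeneous_X _ _ _
  rw [mem_weightedHomogeneousSubmodule]
  have h1 : IsWeightedHomogeneous (weight m) (∑ j : Fin (m + 1), C (c j) *
      X (Sum.inl 0) ^ (j : ℕ) * X (Sum.inl 1) ^ (m - (j : ℕ)) : MvPolynomial Var K) (0, (m : ℤ)) := by
    refine IsWeightedHomogeneous.sum _ _ _ fun j _ => ?_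
    have h2 := (((isWeightedHomogeneous_C (weight m) (c j)).mul
      ((h (Sum.inl 0)).pow (j : ℕ))).mul ((h (Sum.inl 1)).pow (m - (j : ℕ))))
    convert h2 using 1
    have := j.2
    ext
    · simp [weight]
    · simp [weight]; omega
  have h2 : ((0, (m : ℤ)) : ℤ × ℤ) + weight m (Sum.inr 0) = (1, 0) := by simp [weight]
  have h3 := h1.mul (h (Sum.inr 0))
  rw [h2] at h3
  exact (h (Sum.inr 1)).sub h3

theorem sectionForm_ne_zero (c : Fin (m + 1) → K) : sectionForm c ≠ 0 := by
  intro h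
  have := congrArg (eval (Sum.elim 0 ![0, 1])) h
  simp [sectionForm] at this

end Coordinates

/-! ### The dimension of the space of forms -/

section Dimension

variable (K : Type*) [Field K] (m k : ℕ) (a : ℤ)

theorem blocks_eq {e : ℕ} (h : e ≤ k) : (blocks m k a e : ℤ) = max ((k - e) * m + a + 1) 0 := by
  rw [blocks_cast, blockSize, if_pos (by omega)]
  push_cast
  ring_nf

theorem weight_eq_iff (d : Var →₀ ℕ) (k a : ℤ) : Finsupp.weight (weight m) d = (k, a) ↔
    (d (Sum.inr 0) : ℤ) + d (Sum.inr 1) = k ∧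
      (d (Sum.inl 0) : ℤ) + d (Sum.inl 1) - d (Sum.inr 0) * m = a := by
  rw [Finsupp.weight_apply, Finsupp.sum_fintype _ _ (by simp)]
  simp [weight, Prod.ext_iff, sub_eq_add_neg]

/-- The `e`-th block is spanned by the monomials of degree `e` in `u₁`. -/
theorem h0_eq_sum : h0 K m k a = ∑ e ∈ range (k + 1), blocks m k a e := by
  let f : (Σ e : Fin (k + 1), Fin (blocks m k a e)) → Var →₀ ℕ := fun y =>
    Finsupp.equivFunOnFinite.symm (Sum.elim ![y.2.1, blocks m k a y.1 - 1 - y.2.1] ![k - y.1, y.1])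
  have hf : ∀ y, f y ∈ {d : Var →₀ ℕ | Finsupp.weight (weight m) d = ((k : ℤ), a)} := by
    rintro ⟨⟨e, he⟩, ⟨p, hp⟩⟩
    have h1 := blocks_eq m k a (Nat.lt_succ_iff.1 he)
    rw [Set.mem_ofPred_eq, weight_eq_iff]
    simp only [f, Finsupp.equivFunOnFinite_symm_apply_apply, Sum.elim_inl, Sum.elim_inr,
      Matrix.cons_val_zero, Matrix.cons_val_one]
    simp only at hp
    have h2 : (((k - e : ℕ) : ℤ)) = k - e := by omega
    rw [h2]
    omega
  have hbij : Function.Bijective fun y =>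
      (⟨f y, hf y⟩ : {d : Var →₀ ℕ | Finsupp.weight (weight m) d = ((k : ℤ), a)}) := by
    constructor
    · rintro ⟨⟨e, he⟩, ⟨p, hp⟩⟩ ⟨⟨e', he'⟩, ⟨p', hp'⟩⟩ h
      have h1 : e = e' := DFunLike.congr_fun (congrArg Subtype.val h) (Sum.inr 1)
      subst h1
      have h2 : p = p' := DFunLike.congr_fun (congrArg Subtype.val h) (Sum.inl 0)
      subst h2
      rfl
    · rintro ⟨d, hd⟩
      have hd' := hd
      rw [Set.mem_ofPred_eq, weight_eq_iff] at hd'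
      obtain ⟨h1, h2⟩ := hd'
      have he : d (Sum.inr 1) ≤ k := by omega
      have h3 := blocks_eq m k a he
      have h4 : (k : ℤ) - d (Sum.inr 1) = d (Sum.inr 0) := by omega
      rw [h4] at h3
      refine ⟨⟨⟨d (Sum.inr 1), by omega⟩, ⟨d (Sum.inl 0), by simp only; omega⟩⟩,
        Subtype.ext (Finsupp.ext fun v => ?_)⟩
      rcases v with v | v <;> fin_cases v <;> simp [f] <;> omega
  have hfin : Module.finrank K (forms K m k a) =
      Nat.card {d : Var →₀ ℕ | Finsupp.weight (weight m) d = ((k : ℤ), a)} := by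
    rw [forms, weightedHomogeneousSubmodule_eq_finsupp_supported]
    exact Module.finrank_eq_nat_card_basis (basisRestrictSupport K _)
  rw [h0, hfin, ← Nat.card_eq_of_bijective _ hbij, Nat.card_eq_fintype_card, Fintype.card_sigma]
  simp only [Fintype.card_fin]
  exact Fin.sum_univ_eq_sum_range (fun e => blocks m k a e) (k + 1)

/-- The first `p` blocks of class `(k, a)` account for the difference with class `(k - p, a)`. -/
theorem h0_le_h0_sub_add {p : ℕ} (hp : p ≤ k + 1) :
    h0 K m k a ≤ h0 K m (k - p) a + ∑ e ∈ range p, blocks m k a e := by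
  rw [h0_eq_sum]
  rcases hp.lt_or_eq with h | rfl
  · obtain ⟨l, rfl⟩ := Nat.exists_eq_add_of_le (Nat.lt_succ_iff.1 h)
    have h1 : ((p + l : ℕ) : ℤ) - p = (l : ℕ) := by push_cast; ring
    have h2 : ∀ e ∈ range (l + 1), blocks m (p + l) a (p + e) = blocks m l a e := fun e he => by
      have he' := Nat.lt_succ_iff.1 (mem_range.1 he)
      have h3 := blocks_eq m l a he'
      have h4 := blocks_eq m (p + l) a (e := p + e) (by omega)
      have h5 : ((p + l : ℕ) : ℤ) - (p + e : ℕ) = l - e := by push_cast; ring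
      rw [h5] at h4
      omega
    rw [h1, h0_eq_sum, add_assoc, sum_range_add, sum_congr rfl h2, add_comm]
  · exact Nat.le_add_left _ _

end Dimension

/-! ### Independent conditions and bounds for the dimension -/

section Bounds
variable {K : Type*} [Field K] {m u : ℕ} {s : ℕ → ℕ}

/-- The points with index in `T` impose independent conditions on the forms of class `(k, a)`:
for each of them some form vanishes at all the others but not at it. -/
def ImposeIndependentConditions (k : ℕ) (a : ℤ) (T : Finset (Σ i : Finset.Icc 1 u, Fin (s i)))
    (x : Params K m u s) : Prop :=
  ∀ y ∈ T, ∃ F ∈ forms K m k a, ¬ VanishesAt F (point x y) ∧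
    ∀ y' ∈ T, y' ≠ y → VanishesAt F (point x y')

theorem params_eq_mk (x : Params K m u s) :
    ∃ v : (Σ i : Finset.Icc 1 u, Fin (s i)) → { v : Fin 2 → K // v ≠ 0 },
      x = (x.1, fun y => Projectivization.mk K (v y).1 (v y).2) :=
  ⟨fun y => ⟨(x.2 y).rep, (x.2 y).rep_nonzero⟩,
    Prod.ext rfl (_root_.funext fun y => (x.2 y).mk_rep.symm)⟩

/-- The evaluation of forms at a family of coordinate vectors, as a linear map. -/
noncomputable def evalForms (k a : ℤ) {ι : Type*} (p : ι → Coords K) :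
    forms K m k a →ₗ[K] (ι → K) :=
  LinearMap.pi fun i => (aeval (p i).val).toLinearMap ∘ₗ (forms K m k a).subtype

theorem evalForms_apply (k a : ℤ) {ι : Type*} (p : ι → Coords K) (F : forms K m k a) (i : ι) :
    evalForms k a p F i = eval (p i).val F.1 := by
  simp [evalForms]

theorem h0Ideal_add_card_le {k : ℕ} {a : ℤ} {T : Finset (Σ i : Finset.Icc 1 u, Fin (s i))}
    {x : Params K m u s} (h : ImposeIndependentConditions k a T x) :
    h0Ideal K m k a (points x) + #T ≤ h0 K m k a := by
  obtain ⟨v, hv⟩ := params_eq_mk x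
  obtain ⟨c, hc⟩ : ∃ c, c = x.1 := ⟨_, rfl⟩
  rw [← hc] at hv
  subst hv
  let p : T → Coords K := fun y => sectionCoords (c y.1.1) (v y.1)
  let L := evalForms (m := m) (k : ℤ) a p
  have hsurj : Function.Surjective L := by
    intro w
    choose F hF hF1 hF2 using h
    have hy : ∀ y : T, eval (p y).val (F y.1 y.2) ≠ 0 := fun y h0 =>
      hF1 y.1 y.2 ((vanishesAt_sectionPoint (hF y.1 y.2) _ _).2 h0)
    have hy' : ∀ y y' : T, y' ≠ y → eval (p y').val (F y.1 y.2) = 0 := fun y y' hne =>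
      (vanishesAt_sectionPoint (hF y.1 y.2) _ _).1
        (hF2 y.1 y.2 y'.1 y'.2 fun h => hne (Subtype.ext h))
    refine ⟨∑ y : T, (w y / eval (p y).val (F y.1 y.2)) • ⟨F y.1 y.2, hF y.1 y.2⟩, ?_⟩
    ext y
    rw [map_sum, Finset.sum_apply, Finset.sum_eq_single y]
    · rw [map_smul, Pi.smul_apply, evalForms_apply, smul_eq_mul, div_mul_cancel₀ _ (hy y)]
    · intro y' _ hne
      rw [map_smul, Pi.smul_apply, evalForms_apply, hy' y' y hne.symm, smul_zero]
    · simp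
  have h1 := L.finrank_range_add_finrank_ker
  rw [LinearMap.range_eq_top.2 hsurj, finrank_top, Module.finrank_fintype_fun_eq_card,
    Fintype.card_coe] at h1
  have h2 : h0Ideal K m k a (points (c, fun y => Projectivization.mk K (v y).1 (v y).2)) ≤
      Module.finrank K (LinearMap.ker L) := by
    rw [← Submodule.finrank_map_subtype_eq]
    refine Submodule.finrank_mono fun F hF => ?_
    refine ⟨⟨F, hF.1⟩, ?_, rfl⟩
    rw [SetLike.mem_coe, LinearMap.mem_ker]
    ext y
    rw [evalForms_apply]
    exact (vanishesAt_sectionPoint hF.1 _ _).1 (hF.2 _ ⟨y.1, rfl⟩)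
  unfold h0
  omega

/-- Multiplication by the equations of the first `p` sections embeds the forms of class
`(k - p, a)` through the points of the remaining sections into the forms of class `(k, a)`
through all the points. -/
theorem h0_le_h0Ideal_add (k : ℕ) (a : ℤ) (x : Params K m u s) {p : ℕ} (hp : p ≤ u) :
    h0 K m (k - p) a ≤ h0Ideal K m k a (points x) + ∑ i ∈ Ioc p u, s i := by
  classical
  obtain ⟨v, hv⟩ := params_eq_mk x
  obtain ⟨c, hc⟩ : ∃ c, c = x.1 := ⟨_, rfl⟩
  rw [← hc] at hv
  subst hv
  let A : Finset (Finset.Icc 1 u) := {i | i.1 ≤ p}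
  let R : Finset (Σ i : Finset.Icc 1 u, Fin (s i)) := {y | p < y.1.1}
  have hA : #A = p := by
    rw [← card_map (Function.Embedding.subtype _)]
    have : A.map (Function.Embedding.subtype _) = Icc 1 p := by
      ext i
      simp only [A, mem_map, mem_filter, mem_univ, true_and, Function.Embedding.subtype_apply,
        Subtype.exists, mem_Icc]
      constructor
      · rintro ⟨j, hj, h, rfl⟩; omega
      · intro h; exact ⟨i, by omega, by omega, rfl⟩
    rw [this]; simp
  have hR : #R = ∑ i ∈ Ioc p u, s i := by
    have h1 : R = (univ.filter fun i : Finset.Icc 1 u => p < i.1).sigma fun _ => univ := by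
      ext y; simp [R]
    rw [h1, card_sigma]
    simp only [card_univ, Fintype.card_fin]
    refine sum_bij (fun i _ => i.1) ?_ (fun i _ j _ h => Subtype.ext h) ?_ fun _ _ => rfl
    · intro i hi
      have := mem_Icc.1 i.2
      simp at hi ⊢; omega
    · intro i hi
      have := mem_Ioc.1 hi
      exact ⟨⟨i, mem_Icc.2 (by omega)⟩, by simp; omega, rfl⟩
  let Q : MvPolynomial Var K := ∏ i ∈ A, sectionForm (c i)
  have hQ : IsWeightedHomogeneous (weight m) Q ((p : ℤ), 0) := by
    have := IsWeightedHomogeneous.prod A (fun i => sectionForm (c i)) (fun _ => ((1 : ℤ), (0 : ℤ)))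
      fun i _ => sectionForm_mem (c i)
    convert this using 1
    simp [hA]
  have hQ0 : Q ≠ 0 := prod_ne_zero_iff.2 fun i _ => sectionForm_ne_zero _
  let L := evalForms (m := m) ((k : ℤ) - p) a fun y : R => sectionCoords (c y.1.1) (v y.1)
  have h1 := L.finrank_range_add_finrank_ker
  have h2 : Module.finrank K (LinearMap.range L) ≤ #R := by
    refine (Submodule.finrank_le _).trans ?_
    rw [Module.finrank_fintype_fun_eq_card, Fintype.card_coe]
  have hmem : ∀ F : LinearMap.ker L, Q * F.1.1 ∈ formsThrough K m k a
      (points (c, fun y => Projectivization.mk K (v y).1 (v y).2)) := by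
    rintro ⟨⟨F, hF⟩, hF'⟩
    have hQF : Q * F ∈ forms K m k a := by
      have := hQ.mul hF
      rw [mem_weightedHomogeneousSubmodule]
      convert this using 1
      simp
    refine ⟨hQF, ?_⟩
    rintro _ ⟨y, rfl⟩
    refine (vanishesAt_sectionPoint hQF _ _).2 ?_
    rw [map_mul]
    by_cases hy : p < y.1.1
    · have : eval (sectionCoords (c y.1) (v y)).val F = 0 := by
        have h := congrFun (LinearMap.mem_ker.1 hF') ⟨y, by simp [R, hy]⟩
        rwa [evalForms_apply] at h
      rw [this, mul_zero]
    · have : eval (sectionCoords (c y.1) (v y)).val Q = 0 := by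
        simp only [Q, map_prod]
        refine prod_eq_zero (i := y.1) (by simp [A]; omega) ?_
        rw [eval_sectionForm, sub_self]
      rw [this, zero_mul]
  let Φ : LinearMap.ker L →ₗ[K] formsThrough K m k a
      (points (c, fun y => Projectivization.mk K (v y).1 (v y).2)) :=
    LinearMap.codRestrict _ (LinearMap.mulLeft K Q ∘ₗ (forms K m (k - p) a).subtype ∘ₗ
      (LinearMap.ker L).subtype) hmem
  have h3 : Module.finrank K (LinearMap.ker L) ≤ h0Ideal K m k a
      (points (c, fun y => Projectivization.mk K (v y).1 (v y).2)) := by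
    refine LinearMap.finrank_le_finrank_of_injective (f := Φ) fun F G h => ?_
    have h' : Q * F.1.1 = Q * G.1.1 := congrArg Subtype.val h
    exact Subtype.ext (Subtype.ext (mul_left_cancel₀ hQ0 h'))
  unfold h0
  omega

end Bounds

/-! ### Independence of conditions is an open property -/

section Open
variable {K : Type*} [Field K] {m u : ℕ} {s : ℕ → ℕ}

theorem imposeIndependentConditions_of_det_ne_zero {k : ℕ} {a : ℤ}
    {T : Finset (Σ i : Finset.Icc 1 u, Fin (s i))} (c : Finset.Icc 1 u → Fin (m + 1) → K)
    (v : (Σ i : Finset.Icc 1 u, Fin (s i)) → { v : Fin 2 → K // v ≠ 0 })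
    {F : T → MvPolynomial Var K} (hF : ∀ y, F y ∈ forms K m k a)
    (h : (Matrix.of fun y y' : T =>
      eval (sectionCoords (c y.1.1) (v y.1)).val (F y')).det ≠ 0) :
    ImposeIndependentConditions k a T (c, fun y => Projectivization.mk K (v y).1 (v y).2) := by
  classical
  intro y hy
  set M := Matrix.of fun y y' : T => eval (sectionCoords (c y.1.1) (v y.1)).val (F y') with hM
  obtain ⟨w, hw⟩ : ∃ w, M.mulVec w = Pi.single ⟨y, hy⟩ 1 :=
    ⟨M⁻¹.mulVec (Pi.single ⟨y, hy⟩ 1), by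
      rw [Matrix.mulVec_mulVec, Matrix.mul_nonsing_inv _ (isUnit_iff_ne_zero.2 h),
        Matrix.one_mulVec]⟩
  have hmem : ∑ y', w y' • F y' ∈ forms K m k a :=
    Submodule.sum_mem _ fun y' _ => Submodule.smul_mem _ _ (hF y')
  have hev : ∀ y' : T, eval (sectionCoords (c y'.1.1) (v y'.1)).val (∑ y', w y' • F y') =
      (Pi.single ⟨y, hy⟩ 1 : T → K) y' := by
    intro y'
    rw [← hw, map_sum]
    simp only [smul_eval, Matrix.mulVec, dotProduct, hM, Matrix.of_apply]
    exact sum_congr rfl fun _ _ => mul_comm _ _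
  refine ⟨_, hmem, ?_, fun y' hy' hne => ?_⟩
  · refine (vanishesAt_sectionPoint hmem _ _).not.2 ?_
    rw [hev ⟨y, hy⟩]
    simp
  · refine (vanishesAt_sectionPoint hmem _ _).2 ?_
    rw [hev ⟨y', hy'⟩, Pi.single_eq_of_ne]
    exact fun h => hne (congrArg Subtype.val h)

/-- The homogeneous coordinates of the point with index `y` as polynomials in the parameters. -/
noncomputable def genericCoords (y : Σ i : Finset.Icc 1 u, Fin (s i)) : Var → MvPolynomial
    ((Finset.Icc 1 u × Fin (m + 1)) ⊕ ((Σ i : Finset.Icc 1 u, Fin (s i)) × Fin 2)) K :=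
  Sum.elim (fun j => X (Sum.inr (y, j))) ![1, ∑ j : Fin (m + 1), X (Sum.inl (y.1, j)) *
    X (Sum.inr (y, 0)) ^ (j : ℕ) * X (Sum.inr (y, 1)) ^ (m - (j : ℕ))]

theorem eval_bind₁_genericCoords (c : Finset.Icc 1 u → Fin (m + 1) → K)
    (v : (Σ i : Finset.Icc 1 u, Fin (s i)) → { v : Fin 2 → K // v ≠ 0 })
    (y : Σ i : Finset.Icc 1 u, Fin (s i)) (F : MvPolynomial Var K) :
    eval (Sum.elim (fun y => c y.1 y.2) (fun y => (v y.1).1 y.2)) (bind₁ (genericCoords y) F) =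
      eval (sectionCoords (c y.1) (v y)).val F := by
  rw [eval, eval₂Hom_bind₁]
  congr 2
  ext (j | j)
  · simp [genericCoords, sectionCoords, Coords.val]
  · fin_cases j <;> simp [genericCoords, sectionCoords, Coords.val, binaryForm]

theorem isZariskiOpen_imposeIndependentConditions (k : ℕ) (a : ℤ)
    (T : Finset (Σ i : Finset.Icc 1 u, Fin (s i))) :
    IsZariskiOpen {x : Params K m u s | ImposeIndependentConditions k a T x} := by
  classical
  intro c v h
  choose F hF hF1 hF2 using h
  let G (c : Finset.Icc 1 u → Fin (m + 1) → K)
      (v : (Σ i : Finset.Icc 1 u, Fin (s i)) → { v : Fin 2 → K // v ≠ 0 }) : Matrix T T K :=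
    Matrix.of fun y y' => eval (sectionCoords (c y.1.1) (v y.1)).val (F y'.1 y'.2)
  have hdet : ∀ c v, eval (Sum.elim (fun y => c y.1 y.2) (fun y => (v y.1).1 y.2))
      (Matrix.of fun y y' : T => bind₁ (genericCoords (m := m) y.1) (F y'.1 y'.2)).det =
        (G c v).det := by
    intro c v
    rw [RingHom.map_det]
    congr 1
    ext y y'
    simp [G, eval_bind₁_genericCoords]
  refine ⟨_, (hdet c v).trans_ne ?_, fun c' v' h' => ?_⟩
  · have : G c v = Matrix.diagonal fun y => G c v y y := by
      ext y y'
      rcases eq_or_ne y y' with rfl | hne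
      · simp
      · rw [Matrix.diagonal_apply_ne _ hne]
        exact (vanishesAt_sectionPoint (hF y'.1 y'.2) _ _).1
          (hF2 y'.1 y'.2 y.1 y.2 fun h => hne (Subtype.ext h))
    rw [this, Matrix.det_diagonal]
    refine prod_ne_zero_iff.2 fun y _ h0 => hF1 y.1 y.2 ?_
    exact (vanishesAt_sectionPoint (hF y.1 y.2) _ _).2 h0
  · rw [hdet] at h'
    exact imposeIndependentConditions_of_det_ne_zero c' v' (fun y => hF y.1 y.2) h'

end Open

/-! ### Independent points on a grid -/

section Grid
variable {K : Type*} [Field K]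

/-- The binary form `γ t₁ᵐ`. -/
def constantForm (m : ℕ) (γ : K) : Fin (m + 1) → K := fun j => if j = 0 then γ else 0

theorem binaryForm_constantForm (m : ℕ) (γ : K) (v : Fin 2 → K) :
    binaryForm (constantForm m γ) v = γ * v 1 ^ m := by
  rw [binaryForm, Finset.sum_eq_single 0]
  · simp [constantForm]
  · intro j _ hj; simp [constantForm, hj]
  · simp

/-- The product of the fibres `t₀ = b' t₁` with `b' < b`, of the sections `u₁ = i t₁ᵐ u₀` with
`i ∈ B`, and of powers of `t₁` and `u₀`. -/
noncomputable def gridForm (m : ℕ) (b : ℕ) (B : Finset ℕ) (α β : ℕ) : MvPolynomial Var K :=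
  (∏ b' ∈ range b, (X (Sum.inl 0) - C (b' : K) * X (Sum.inl 1))) *
    (∏ i ∈ B, sectionForm (constantForm m (i : K))) * X (Sum.inl 1) ^ α * X (Sum.inr 0) ^ β

theorem gridForm_mem {m b : ℕ} {B : Finset ℕ} {α β : ℕ} {k a : ℤ} (hk : (#B : ℤ) + β = k)
    (ha : (b : ℤ) + α - β * m = a) : gridForm m b B α β ∈ forms K m k a := by
  have h : ∀ v : Var, IsWeightedHomogeneous (weight m) (X v : MvPolynomial Var K) (weight m v) :=
    fun v => isWeightedHomogeneous_X _ _ _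
  have h1 : IsWeightedHomogeneous (weight m)
      (∏ b' ∈ range b, (X (Sum.inl 0) - C (b' : K) * X (Sum.inl 1)) : MvPolynomial Var K)
      (∑ _b' ∈ range b, ((0, 1) : ℤ × ℤ)) :=
    IsWeightedHomogeneous.prod _ _ _ fun b' _ => (h (Sum.inl 0)).sub ((h (Sum.inl 1)).C_mul _)
  have h2 := IsWeightedHomogeneous.prod B (fun i => sectionForm (constantForm m (i : K)))
    (fun _ => ((1 : ℤ), (0 : ℤ))) fun i _ => sectionForm_mem _
  have h3 := ((h1.mul h2).mul ((h (Sum.inl 1)).pow α)).mul ((h (Sum.inr 0)).pow β)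
  rw [mem_weightedHomogeneousSubmodule]
  have h4 : ∑ _b' ∈ range b, ((0, 1) : ℤ × ℤ) + ∑ _i ∈ B, ((1, 0) : ℤ × ℤ) +
      α • weight m (Sum.inl 1) + β • weight m (Sum.inr 0) = (k, a) := by
    ext
    · simp [weight, ← hk]
    · simp [weight, ← ha]; ring
  rwa [h4] at h3

/-- The coordinate vector `(b, 1)`. -/
def gridVector (b : ℕ) : { v : Fin 2 → K // v ≠ 0 } :=
  ⟨![(b : K), 1], fun h => by simpa using congrFun h 1⟩

theorem eval_gridForm (m b : ℕ) (B : Finset ℕ) (α β b₀ i₀ : ℕ) :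
    eval (sectionCoords (constantForm m (i₀ : K)) (gridVector b₀)).val (gridForm m b B α β) =
      (∏ b' ∈ range b, ((b₀ : K) - b')) * ∏ i ∈ B, ((i₀ : K) - i) := by
  simp only [gridForm, map_mul, map_prod, map_pow, eval_sectionForm, binaryForm_constantForm]
  simp [sectionCoords, Coords.val, gridVector]

/-- For nonincreasing `D` the indices with `b < D i` form an initial segment. -/
theorem lt_of_lt_card_filter {D : ℕ → ℕ} (hD : Antitone D) {N b e : ℕ}
    (h : e < #{i ∈ range N | b < D i}) : b < D e := by
  by_contra hb
  refine absurd h (not_lt.2 ?_)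
  refine (card_le_card (t := range e) fun i hi => ?_).trans (card_range e).le
  rw [mem_filter] at hi
  rw [mem_range]
  by_contra hi'
  have := hD (not_lt.1 hi')
  omega

/-- For suitable parameters there are independent points in the number given by the greedy choice.
The points of the `i`-th section are put on the fibres `t₀ = b t₁` with `b` in the `i`-th row of a
0-1-matrix from `exists_rows_of_sum_le`. -/
theorem exists_imposeIndependentConditions [CharZero K] (m k : ℕ) (a : ℤ) {u : ℕ} {s : ℕ → ℕ}
    (hs : ∀ i j : ℕ, 1 ≤ i → i ≤ j → j ≤ u → s j ≤ s i) :
    ∃ T : Finset (Σ i : Finset.Icc 1 u, Fin (s i)),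
      #T = ∑ i ∈ range u, truncated (blocks m k a) (sizes u s) i ∧
      ∃ x : Params K m u s, ImposeIndependentConditions k a T x := by
  classical
  set D := blocks m k a with hD
  have hDanti : Antitone D := antitone_blocks m k a
  set r := truncated D (sizes u s) with hr
  obtain ⟨M, hM, hcol⟩ := exists_rows_of_sum_le D r (u + k + 1)
    (antitone_truncated hDanti (antitone_sizes hs))
    fun j _ => (Nat.le_add_right _ _).trans_eq (sum_truncated_add_slack D (sizes u s) j)
  have hrs : ∀ i : Finset.Icc 1 u, r (i - 1) ≤ s i := fun i => by
    have h1 := mem_Icc.1 i.2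
    have h2 : sizes u s (i.1 - 1) = s i := by
      rw [sizes, if_pos (by omega)]; congr 1; omega
    rw [← h2]
    exact min_le_left _ _
  have hM' : ∀ i : Finset.Icc 1 u, #(M (i - 1)) = r (i - 1) := fun i =>
    hM _ (by have := mem_Icc.1 i.2; omega)
  let T : Finset (Σ i : Finset.Icc 1 u, Fin (s i)) := {y | (y.2 : ℕ) < r (y.1 - 1)}
  -- `col y` is the fibre of the point `y`; its value outside `T` does not matter.
  let col (y : Σ i : Finset.Icc 1 u, Fin (s i)) : ℕ :=
    if h : (y.2 : ℕ) < r (y.1 - 1) then (M (y.1 - 1)).orderEmbOfFin (hM' y.1) ⟨y.2, h⟩ else 0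
  have hcolmem : ∀ y ∈ T, col y ∈ M (y.1 - 1) := fun y hy => by
    have hy' := (mem_filter.1 hy).2
    simp only [col, dif_pos hy']
    exact orderEmbOfFin_mem _ _ _
  have hcolinj : ∀ y ∈ T, ∀ y' ∈ T, y.1 = y'.1 → col y = col y' → y = y' := by
    rintro ⟨i, l⟩ hy ⟨i', l'⟩ hy' (rfl : i = i') h
    have h1 := (mem_filter.1 hy).2
    have h2 := (mem_filter.1 hy').2
    simp only [col, dif_pos h1, dif_pos h2] at h
    have h3 := ((M (i - 1)).orderEmbOfFin (hM' i)).injective h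
    simp only [Fin.mk.injEq] at h3
    rw [Fin.ext h3]
  -- `B y` lists the sections through the other points of `T` on the fibre of `y`.
  let B (y : Σ i : Finset.Icc 1 u, Fin (s i)) : Finset ℕ :=
    {i ∈ Icc 1 u | col y ∈ M (i - 1)}.erase y.1
  have hB : ∀ y ∈ T, col y < D #(B y) := fun y hy => by
    refine lt_of_lt_card_filter hDanti (N := u + k + 1) (lt_of_lt_of_le ?_ (hcol (col y)))
    rw [Nat.lt_iff_add_one_le, card_erase_add_one (mem_filter.2 ⟨y.1.2, hcolmem y hy⟩)]
    refine card_le_card_of_injOn (fun i => i - 1) (fun i hi => ?_) fun i hi j hj h => ?_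
    · have h1 := mem_filter.1 hi
      have h2 := mem_Icc.1 h1.1
      exact mem_filter.2 ⟨mem_range.2 (by simp only; omega), h1.2⟩
    · have h1 := mem_Icc.1 (mem_filter.1 hi).1
      have h2 := mem_Icc.1 (mem_filter.1 hj).1
      simp only at h
      omega
  refine ⟨T, ?_, (fun i => constantForm m (i.1 : K), fun y => Projectivization.mk K
    (gridVector (col y)).1 (gridVector (col y)).2), ?_⟩
  · have h1 : T = (univ : Finset (Finset.Icc 1 u)).sigma fun i =>
        ({l : Fin (s i) | (l : ℕ) < r (i - 1)} : Finset _) := by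
      ext y; simp [T]
    rw [h1, card_sigma]
    refine sum_bij (fun i _ => i.1 - 1) ?_ (fun i _ j _ h => ?_) ?_ fun i _ => ?_
    · intro i _
      have := mem_Icc.1 i.2
      exact mem_range.2 (by omega)
    · have := mem_Icc.1 i.2
      have := mem_Icc.1 j.2
      exact Subtype.ext (by omega)
    · intro i hi
      have := mem_range.1 hi
      exact ⟨⟨i + 1, mem_Icc.2 (by omega)⟩, mem_univ _, by simp⟩
    · rw [Fin.card_filter_val_lt, min_eq_right (hrs i)]
  · refine imposeIndependentConditions_of_det_ne_zero (F := fun y => gridForm m (col y.1) (B y.1)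
      (D #(B y.1) - 1 - col y.1) (k - #(B y.1))) _ (fun y => gridVector (col y)) (fun y => ?_) ?_
    · have h1 := hB y.1 y.2
      have h2 : #(B y.1) ≤ k := by
        by_contra h2
        have h3 := blocks_cast m k a #(B y.1)
        rw [← hD, blockSize, if_neg (by omega)] at h3
        omega
      have h3 := blocks_eq m k a h2
      have h4 : ((k - #(B y.1) : ℕ) : ℤ) = k - #(B y.1) := by omega
      rw [← h4, ← hD] at h3
      exact gridForm_mem (by omega) (by omega)
    · intro h0
      obtain ⟨w, hw0, hw⟩ := Matrix.exists_mulVec_eq_zero_iff.2 h0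
      have hne : (univ.filter fun y => w y ≠ 0).Nonempty := by
        obtain ⟨y, hy⟩ := Function.ne_iff.1 hw0
        exact ⟨y, by simpa using hy⟩
      -- The matrix is triangular: evaluating a linear relation at a point of the leftmost fibre
      -- that occurs in it leaves only the term of that point.
      obtain ⟨y, hy, hmin⟩ := exists_min_image _ (fun y : T => col y.1) hne
      have h1 := congrFun hw y
      simp only [Matrix.mulVec, dotProduct, Matrix.of_apply, eval_gridForm, Pi.zero_apply] at h1
      rw [Finset.sum_eq_single y] at h1
      · refine mul_ne_zero (mul_ne_zero ?_ ?_) (mem_filter.1 hy).2 h1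
        · refine prod_ne_zero_iff.2 fun b hb => sub_ne_zero.2 ?_
          exact_mod_cast (mem_range.1 hb).ne'
        · refine prod_ne_zero_iff.2 fun i hi => sub_ne_zero.2 ?_
          exact_mod_cast (mem_erase.1 hi).1.symm
      · intro y' _ hne'
        by_cases hw' : w y' = 0
        · rw [hw', mul_zero]
        have hle := hmin y' (by simpa using hw')
        rcases hle.lt_or_eq with hlt | heq
        · rw [prod_eq_zero (mem_range.2 hlt) (sub_self _), zero_mul, zero_mul]
        · have hi : y.1.1 ≠ y'.1.1 := fun h =>
            hne' (Subtype.ext (hcolinj y.1 y.2 y'.1 y'.2 h heq)).symm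
          have hmem : y.1.1.1 ∈ B y'.1 := by
            refine mem_erase.2 ⟨fun h => hi (Subtype.ext h), mem_filter.2 ⟨y.1.1.2, ?_⟩⟩
            rw [← heq]
            exact hcolmem y.1 y.2
          rw [prod_eq_zero hmem (sub_self _), mul_zero, zero_mul]
      · simp

end Grid

end Hirzebruch

theorem mainTheorem7 {K : Type*} [Field K] [IsAlgClosed K] [CharZero K]
    (m k : ℕ) (a : ℤ) (u : ℕ) (s : ℕ → ℕ)
    (hs_anti : ∀ i j : ℕ, 1 ≤ i → i ≤ j → j ≤ u → s j ≤ s i)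
    (hs_pos : ∀ i : ℕ, 1 ≤ i → i ≤ u → 0 < s i) :
    Hirzebruch.HoldsGenerally (fun x : Hirzebruch.Params K m u s =>
      Function.Injective (Hirzebruch.point x) ∧
      ((∃ t : ℕ, k + 1 < Hirzebruch.index m k a u s t) →
        Hirzebruch.h0Ideal K m k a (Hirzebruch.points x) = 0) ∧
      ((¬ ∃ t : ℕ, k + 1 < Hirzebruch.index m k a u s t) →
        (Hirzebruch.h0Ideal K m k a (Hirzebruch.points x) : ℤ) =
          (Hirzebruch.h0 K m k a : ℤ) - ∑ i ∈ Finset.Icc 1 u, (s i : ℤ)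
            - ∑ t ∈ Finset.range u, Hirzebruch.sigma m k a s
                (Hirzebruch.index m k a u s t) (Hirzebruch.index m k a u s (t + 1)))) := by
  open Hirzebruch in
  have : Infinite K := Infinite.of_injective _ (Nat.cast_injective (R := K))
  obtain ⟨T, hT, x₀, hx₀⟩ := exists_imposeIndependentConditions (K := K) m k a hs_anti
  obtain ⟨U, hU, hne, hUP⟩ := holdsGenerally_point_injective (K := K) (m := m) (u := u) (s := s)
    |>.and ⟨_, isZariskiOpen_imposeIndependentConditions k a T, ⟨x₀, hx₀⟩, fun _ h => h⟩
  refine ⟨U, hU, hne, fun x hx => ?_⟩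
  obtain ⟨hinj, himp⟩ := hUP x hx
  have hle := h0Ideal_add_card_le himp
  have hcard := sum_truncated m k a u s
  rw [← hT] at hcard
  -- `p` is the last of the indices `iₜ`.
  obtain ⟨p, hp⟩ : ∃ p, p = Hirzebruch.index m k a u s u := ⟨_, rfl⟩
  have hpu : p ≤ u := hp ▸ index_le m k a u s u
  have hfin : (∃ t, k + 1 < Hirzebruch.index m k a u s t) ↔ k + 1 < p :=
    ⟨fun ⟨t, ht⟩ => hp ▸ ht.trans_le (index_le_index m k a u s t), fun h => ⟨u, hp ▸ h⟩⟩
  rw [hfin, sum_sigma_index, ← hp]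
  rw [← hp] at hcard
  have hsig : sigma m k a s 0 p = ((∑ i ∈ Finset.range p, blocks m k a i : ℕ) : ℤ) -
      ∑ i ∈ Finset.Ioc 0 p, (s i : ℤ) := sigma_zero m k a s p
  have hsplit : ∑ i ∈ Finset.Ioc 0 p, (s i : ℤ) + ∑ i ∈ Finset.Ioc p u, (s i : ℤ) =
      ∑ i ∈ Finset.Icc 1 u, (s i : ℤ) := Finset.sum_Ioc_consecutive _ (Nat.zero_le _) hpu
  have hh0 := h0_eq_sum K m k a
  refine ⟨hinj, fun h => ?_, fun h => ?_⟩
  · have h1 : ∑ e ∈ Finset.range (k + 1), blocks m k a e ≤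
        ∑ e ∈ Finset.range p, blocks m k a e :=
      Finset.sum_le_sum_of_subset (Finset.range_mono h.le)
    have h2 : 0 ≤ ∑ i ∈ Finset.Ioc p u, (s i : ℤ) := Finset.sum_nonneg fun _ _ => by positivity
    omega
  · have hlow := h0_le_h0Ideal_add k a x hpu
    have hsum : ((∑ i ∈ Finset.Ioc p u, s i : ℕ) : ℤ) = ∑ i ∈ Finset.Ioc p u, (s i : ℤ) := by
      push_cast; rfl
    have hres : h0 K m k a ≤ h0 K m (k - p) a + ∑ e ∈ Finset.range p, blocks m k a e :=
      h0_le_h0_sub_add K m k a (by omega)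
    omega
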